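/- **Setting.** For sets, $C\oplus D$ is the Minkowski sum and $C\ominus D=\{y: y+d\in C\ \forall d\in D\}$; a C-set is a compact set containing $0$, a PC-set a compact set containing $0$ in its interior; a real square matrix is Schur if all its complex eigenvalues have modulus $<1$; $\|x\|_Q^2=x^\top Qx$. Fix convex PC-sets $\mathbb X\subset\mathbb R^n$, $\mathbb U\subset\mathbb R^m$, a compact set $\mathcal M$ of pairs $[A\ B]$, $\alpha\in(0,1)$, a horizon $N\ge1$, $Q\succeq0$ and $R\succ0$. Put $\hat{\mathbb U}=\alpha\mathbb U$ and $\hat{\mathbb W}=\mathbb U\ominus\hat{\mathbb U}$. A *design* is a tuple $(\bar A,\bar B,\mathbb W_p,K_t,\mathbb S,K,\mathbb Z_f,P)$ such that, with $\mathbb W=\bar B\hat{\mathbb W}\oplus\mathbb W_p$, $\mathbb Z=\mathbb X\ominus\mathbb S$, $\mathbb V=\hat{\mathbb U}\ominus K_t\mathbb S$ and $\bar A_K=\bar A+\bar BK$: * $\mathbb W_p$ is a C-set containing $(A-\bar A)x+(B-\bar B)u$ for all $x\in\mathbb X$, $u\in\mathbb U$, $[A\ B]\in\mathcal M$; * $\bar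 A_K$ is Schur, $\mathbb Z_f$ is a convex PC-set, $\bar A_K\mathbb Z_f\subseteq\mathbb Z_f\subseteq\mathbb Z$ and $K\mathbb Z_f\subseteq\mathbb V$; * $\mathbb S\neq\emptyset$, $(\bar A+\bar BK_t)\mathbb S\oplus\mathbb W\subseteq\mathbb S\subseteq\mathbb X$ and $K_t\mathbb S\subseteq\hat{\mathbb U}$; * $\bar A_K^\top P\bar A_K+(Q+K^\top RK)\le P$. The problem $\mathbb P_N(z)$ of a design is to minimize $V_N(z,\boldsymbol v)=\sum_{k=0}^{N-1}(\|z_k\|_Q^2+\|v_k\|_R^2)+\|z_N\|_P^2$ over $\boldsymbol v=(v_0,\dots,v_{N-1})$, subject to $z_0=z$, $z_{k+1}=\bar Az_k+\bar Bv_k$, $z_k\in\mathbb Z$, $v_k\in\mathbb V$ for $k<N$, and $z_N\in\mathbb Z_f$. Let $\mathcal Z_N$ be the set of $z$ for which it is feasible, and let $\kappa(z)$, for $z\in\mathcal Z_N$, be the first element of an optimal sequence. The control law is $\hat\kappa(x,z)=\kappa(z)+K_t(x-z)$. **Proposition.** Let an initial design and a redesign for a model $(\tilde A,\tilde B)$ (same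 $\mathbb X,\mathbb U,\mathcal M,\alpha,N,Q,R$, all its objects written with a tilde) be given. There are constants $c>0$ and $\gamma\in(0,1)$, depending only on the data above, such that the following holds for every switching time $s\ge1$ and every nominal trajectory $z(\cdot)$ with $z(0)\in\mathcal Z_N$, generated by $z(i+1)=\bar Az(i)+\bar B\kappa(z(i))$ for $i<s$ and $z(i+1)=\tilde Az(i)+\tilde B\tilde\kappa(z(i))$ for $i\ge s$, for which $\tilde{\mathbb P}_N(z(s))$ is feasible and $\min_{\boldsymbol v}\tilde V_N(z(s),\boldsymbol v)-\min_{\boldsymbol v}V_N(z(s-1),\boldsymbol v)<0$. Write $d(i)$ and $\tilde d(i)$ for the distances of $(x(i),z(i))$ to $\mathbb S\times\{0\}$ and to $\tilde{\mathbb S}\times\{0\}$. 1. *Recursive feasibility.* $\mathbb P_N(z(i))$ is feasible for all $i<s$ and $\tilde{\mathbb P}_N(z(i))$ is feasible for all $i\ge s$. 2. *Constraint satisfaction and stability for the plant.* Let $x(i+1)=A(i)x(i)+B(i)(\hat u(i)+\hat w(i))$ with arbitrary $[A(i)\ B(i)]\in\mathcal M$ and $\hat w(i)\in\hat{\mathbb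 W}$, where $\hat u(i)$ is given by the initial law $\hat\kappa(x(i),z(i))$ for $i<s$ and by the redesigned law for $i\ge s$, and let $x(0)\in\{z(0)\}\oplus\mathbb S$. Then $x(i)\in\mathbb X$ and $\hat u(i)\in\hat{\mathbb U}$ for all $i<s$, and $d(i)\le c\gamma^i d(0)$ for all $i\le s$. If, moreover, the redesigned tube is correctly initialized at the switch, $x(s)\in\{z(s)\}\oplus\tilde{\mathbb S}$, then $x(i)\in\mathbb X$ and $\hat u(i)\in\hat{\mathbb U}$ for all $i\ge0$, and $\tilde d(i)\le c\gamma^i d(0)$ for all $i\ge s$. 3. *Exponential stability of the composite closed loop.* Let $x(0)\in\mathcal Z_N\oplus\mathbb S$, with $x(i+1)=\bar Ax(i)+\bar B\hat\kappa(x(i),z(i))+w(i)$, $w(i)\in\mathbb W$ arbitrary, for $i<s$, and the same equation with the redesigned quantities and $w(i)\in\tilde{\mathbb W}$ arbitrary for $i\ge s$. Then $d(i)\le c\gamma^id(0)$ for $i\le s$ and $\tilde d(i)\le c\gamma^{i-s}\tilde d(s)$ for $i\ge s$; if also $x(s)\in\{z(s)\}\oplus\tilde{\mathbb S}$, then $\tilde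 d(i)\le c\gamma^id(0)$ for $i\ge s$. -/

import Mathlib

open scoped Pointwise Matrix

noncomputable section

/-- A C-set: a compact set containing the origin. -/
def IsCSet {n : ℕ} (T : Set (Fin n → ℝ)) : Prop :=
  IsCompact T ∧ (0 : Fin n → ℝ) ∈ T

/-- A PC-set: a compact set containing the origin in its interior. -/
def IsPCSet {n : ℕ} (T : Set (Fin n → ℝ)) : Prop :=
  IsCompact T ∧ (0 : Fin n → ℝ) ∈ interior T

/-- The Pontryagin difference `C ⊖ D`. -/
def pontryaginDiff {n : ℕ} (C D : Set (Fin n → ℝ)) : Set (Fin n → ℝ) :=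
  {y | ∀ d ∈ D, y + d ∈ C}

/-- A real square matrix is Schur if its complex eigenvalues lie in the open unit disc. -/
def IsSchur {n : ℕ} (A : Matrix (Fin n) (Fin n) ℝ) : Prop :=
  ∀ μ ∈ spectrum ℂ (A.map (algebraMap ℝ ℂ)), ‖μ‖ < 1

/-- The quadratic form `‖x‖²_Q = xᵀ Q x`. -/
def quadForm {n : ℕ} (Q : Matrix (Fin n) (Fin n) ℝ) (x : Fin n → ℝ) : ℝ :=
  x ⬝ᵥ (Q *ᵥ x)

/-- The image of a set under a matrix. -/
def matImage {n m : ℕ} (L : Matrix (Fin n) (Fin m) ℝ) (T : Set (Fin m → ℝ)) :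
    Set (Fin n → ℝ) :=
  (fun y => L *ᵥ y) '' T

/-- The predictions `z₀ = z`, `z_{k+1} = A z_k + B v_k`. -/
def predict {n m : ℕ} (A : Matrix (Fin n) (Fin n) ℝ) (B : Matrix (Fin n) (Fin m) ℝ)
    (z : Fin n → ℝ) (v : ℕ → Fin m → ℝ) : ℕ → Fin n → ℝ
  | 0 => z
  | k + 1 => A *ᵥ predict A B z v k + B *ᵥ v k

/-- Positive invariance of `T` for `x⁺ = A x`. -/
def IsPI {n : ℕ} (A : Matrix (Fin n) (Fin n) ℝ) (T : Set (Fin n → ℝ)) : Prop :=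
  matImage A T ⊆ T

/-- Robust positive invariance of `T` for `x⁺ = A x + w`, `w ∈ W`. -/
def IsRPI {n : ℕ} (A : Matrix (Fin n) (Fin n) ℝ) (W T : Set (Fin n → ℝ)) : Prop :=
  matImage A T + W ⊆ T

/-- The data of the control problem that a model update does not change: the constraint sets,
the set `M` of possible plant matrices, the input partition, the horizon and the stage weights. -/
structure ControlProblem (n m : ℕ) where
  X : Set (Fin n → ℝ)
  U : Set (Fin m → ℝ)
  M : Set (Matrix (Fin n) (Fin n) ℝ × Matrix (Fin n) (Fin m) ℝ)
  α : ℝ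
  N : ℕ
  Q : Matrix (Fin n) (Fin n) ℝ
  R : Matrix (Fin m) (Fin m) ℝ

/-- A prediction model `(A, B)` with a full set of tube-MPC ingredients. -/
structure TubeDesign (n m : ℕ) where
  A : Matrix (Fin n) (Fin n) ℝ
  B : Matrix (Fin n) (Fin m) ℝ
  Wp : Set (Fin n → ℝ)
  Kt : Matrix (Fin m) (Fin n) ℝ
  S : Set (Fin n → ℝ)
  K : Matrix (Fin m) (Fin n) ℝ
  Zf : Set (Fin n → ℝ)
  P : Matrix (Fin n) (Fin n) ℝ

namespace ControlProblem

variable {n m : ℕ}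

/-- The constraint set of the regulatory part of the input. -/
def Uhat (p : ControlProblem n m) : Set (Fin m → ℝ) := p.α • p.U

/-- The constraint set of the exciting part of the input. -/
def What (p : ControlProblem n m) : Set (Fin m → ℝ) := pontryaginDiff p.U p.Uhat

/-- The standing assumptions on the fixed data. -/
structure Standing (p : ControlProblem n m) : Prop where
  convex_X : Convex ℝ p.X
  pc_X : IsPCSet p.X
  convex_U : Convex ℝ p.U
  pc_U : IsPCSet p.U
  compact_M : IsCompact p.M
  α_pos : 0 < p.α
  α_lt_one : p.α < 1
  N_pos : 0 < p.N
  Q_psd : p.Q.PosSemidef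
  R_pd : p.R.PosDef

end ControlProblem

namespace TubeDesign

variable {n m : ℕ}

/-- The set of lumped disturbances `B Ŵ ⊕ W_p`. -/
def W (D : TubeDesign n m) (p : ControlProblem n m) : Set (Fin n → ℝ) :=
  matImage D.B p.What + D.Wp

/-- The tightened state constraint set `X ⊖ S`. -/
def Z (D : TubeDesign n m) (p : ControlProblem n m) : Set (Fin n → ℝ) :=
  pontryaginDiff p.X D.S

/-- The tightened input constraint set `Û ⊖ K_t S`. -/
def V (D : TubeDesign n m) (p : ControlProblem n m) : Set (Fin m → ℝ) :=
  pontryaginDiff p.Uhat (matImage D.Kt D.S)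

/-- The requirements on a model and its tube-MPC ingredients. -/
structure Admissible (D : TubeDesign n m) (p : ControlProblem n m) : Prop where
  /-- `W_p` is a C-set -/
  cset_Wp : IsCSet D.Wp
  /-- that contains the parametric uncertainty. -/
  unc_mem : ∀ x ∈ p.X, ∀ u ∈ p.U, ∀ AB ∈ p.M,
    (AB.1 - D.A) *ᵥ x + (AB.2 - D.B) *ᵥ u ∈ D.Wp
  /-- `K` is a stabilizing gain -/
  schur_K : IsSchur (D.A + D.B * D.K)
  /-- and `Z_f` is a convex PC-set, -/
  convex_Zf : Convex ℝ D.Zf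
  pc_Zf : IsPCSet D.Zf
  /-- positively invariant under `K` -/
  pi_Zf : IsPI (D.A + D.B * D.K) D.Zf
  /-- and admissible for the tightened constraints of the nominal system. -/
  Zf_sub : D.Zf ⊆ D.Z p
  K_Zf_sub : matImage D.K D.Zf ⊆ D.V p
  /-- `S` is robustly positively invariant under `K_t` -/
  nonempty_S : D.S.Nonempty
  rpi_S : IsRPI (D.A + D.B * D.Kt) (D.W p) D.S
  /-- and admissible. -/
  S_sub : D.S ⊆ p.X
  Kt_S_sub : matImage D.Kt D.S ⊆ p.Uhat
  /-- The terminal weight satisfies `A_Kᵀ P A_K + (Q + Kᵀ R K) ≤ P`. -/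
  lyap : (D.P - ((D.A + D.B * D.K)ᵀ * D.P * (D.A + D.B * D.K)
    + (p.Q + D.Kᵀ * p.R * D.K))).PosSemidef

/-- The constraints of the finite-horizon problem at the nominal state `z`.
Only the entries `v 0, …, v (N-1)` matter. -/
def IsFeasible (D : TubeDesign n m) (p : ControlProblem n m) (z : Fin n → ℝ)
    (v : ℕ → Fin m → ℝ) : Prop :=
  (∀ k < p.N, predict D.A D.B z v k ∈ D.Z p ∧ v k ∈ D.V p) ∧
    predict D.A D.B z v p.N ∈ D.Zf

/-- The set of nominal states at which the finite-horizon problem is feasible. -/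
def feasibleStates (D : TubeDesign n m) (p : ControlProblem n m) : Set (Fin n → ℝ) :=
  {z | ∃ v, D.IsFeasible p z v}

/-- The finite-horizon cost. -/
def cost (D : TubeDesign n m) (p : ControlProblem n m) (z : Fin n → ℝ)
    (v : ℕ → Fin m → ℝ) : ℝ :=
  ∑ k ∈ Finset.range p.N, (quadForm p.Q (predict D.A D.B z v k) + quadForm p.R (v k))
    + quadForm D.P (predict D.A D.B z v p.N)

/-- `v` solves the finite-horizon problem at `z`. -/
def IsOptimal (D : TubeDesign n m) (p : ControlProblem n m) (z : Fin n → ℝ)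
    (v : ℕ → Fin m → ℝ) : Prop :=
  D.IsFeasible p z v ∧ ∀ v', D.IsFeasible p z v' → D.cost p z v ≤ D.cost p z v'

/-- The optimal cost of the finite-horizon problem at `z`. -/
def optCost (D : TubeDesign n m) (p : ControlProblem n m) (z : Fin n → ℝ) : ℝ :=
  sInf (D.cost p z '' {v | D.IsFeasible p z v})

/-- `κ` is the receding-horizon law: the first element of an optimal sequence. -/
def IsControlLaw (D : TubeDesign n m) (p : ControlProblem n m)
    (κ : (Fin n → ℝ) → Fin m → ℝ) : Prop :=
  ∀ z ∈ D.feasibleStates p, ∃ v, D.IsOptimal p z v ∧ κ z = v 0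

/-- The distance of the composite state `(x, z)` to the set `S × {0}`. -/
def tubeDist (D : TubeDesign n m) (x z : Fin n → ℝ) : ℝ :=
  Metric.infDist (x, z) (D.S ×ˢ ({0} : Set (Fin n → ℝ)))

end TubeDesign

/-- The object in use at time `i` when `a` is replaced by `b` at time `s`. -/
def switchAt {β : Type*} (s : ℕ) (a b : β) (i : ℕ) : β := if i < s then a else b

/-- The regulatory input `κ(z) + K_t (x - z)`. -/
def tubeInput {n m : ℕ} (D : TubeDesign n m) (κ : (Fin n → ℝ) → Fin m → ℝ)
    (x z : Fin n → ℝ) : Fin m → ℝ :=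
  κ z + D.Kt *ᵥ (x - z)

/-- The nominal closed loop `z(i+1) = A z(i) + B κ(z(i))`, with time-dependent design. -/
def IsNominalLoop {n m : ℕ} (D : ℕ → TubeDesign n m) (κ : ℕ → (Fin n → ℝ) → Fin m → ℝ)
    (z : ℕ → Fin n → ℝ) : Prop :=
  ∀ i, z (i + 1) = (D i).A *ᵥ z i + (D i).B *ᵥ κ i (z i)

/-- The uncertain time-varying plant `x(i+1) = A(i) x(i) + B(i) u(i)`, `[A(i) B(i)] ∈ M`, with
input `u(i) = û(i) + ŵ(i)`: the tube controller plus an arbitrary exciting part `ŵ(i) ∈ Ŵ`. -/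
def IsPlantLoop {n m : ℕ} (p : ControlProblem n m) (D : ℕ → TubeDesign n m)
    (κ : ℕ → (Fin n → ℝ) → Fin m → ℝ) (x z : ℕ → Fin n → ℝ) : Prop :=
  ∃ (A : ℕ → Matrix (Fin n) (Fin n) ℝ) (B : ℕ → Matrix (Fin n) (Fin m) ℝ)
    (what : ℕ → Fin m → ℝ), ∀ i, (A i, B i) ∈ p.M ∧ what i ∈ p.What ∧
      x (i + 1) = A i *ᵥ x i + B i *ᵥ (tubeInput (D i) (κ i) (x i) (z i) + what i)

/-- The disturbed part `x(i+1) = A x(i) + B κ̂(x(i), z(i)) + w(i)`, `w(i) ∈ W`, of the composite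
closed loop, in terms of the prediction model. -/
def IsDisturbedLoop {n m : ℕ} (p : ControlProblem n m) (D : ℕ → TubeDesign n m)
    (κ : ℕ → (Fin n → ℝ) → Fin m → ℝ) (x z : ℕ → Fin n → ℝ) : Prop :=
  ∀ i, ∃ w ∈ (D i).W p,
    x (i + 1) = (D i).A *ᵥ x i + (D i).B *ᵥ tubeInput (D i) (κ i) (x i) (z i) + w

/-- The state constraint and the constraint on the regulatory input at time `i`. -/
def ConstraintsMet {n m : ℕ} (p : ControlProblem n m) (D : ℕ → TubeDesign n m)
    (κ : ℕ → (Fin n → ℝ) → Fin m → ℝ) (x z : ℕ → Fin n → ℝ) (i : ℕ) : Prop :=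
  x i ∈ p.X ∧ tubeInput (D i) (κ i) (x i) (z i) ∈ p.Uhat

end

/-!
The composite state splits into the nominal state `z` and the tube error `e = x - z`, which obeys
`e⁺ = (A + B K_t) e + w` with `w ∈ W`. Both parts decay exponentially for a single design; a switch
restarts the argument for the second design, and the two exponential bounds multiply.

*Nominal part.* Shifting an optimal sequence and appending the terminal controller gives a feasible
candidate at the successor state (recursive feasibility), whose cost is no larger by the terminal
inequality. As `Q` is only semidefinite, the optimal cost need not be positive definite. As
`Û ⊖ K_t S` need not have `0` in its interior, the control law need not be linear near the origin
either. Instead, strong convexity in the inputs, due to `R ≻ 0`, bounds the deviation `δ` of the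
new optimal sequence from the candidate by the decrease of the optimal cost
(`TubeDesign.IsOptimal.cost_add_le`). Continue the predicted states beyond the horizon by the
terminal controller. The candidate shifts this infinite prediction, so that the weighted supremum
`sup_k ρ⁻ᵏ ‖z_k‖` contracts by the factor `ρ`, up to a multiple of `δ`; here `A + B K` is Schur.
The square of this gauge plus a large multiple of the optimal cost lies between `‖z‖²` and a
multiple of `‖z‖²`, and it contracts in each step (`TubeDesign.Admissible.exists_lyapunov`).

*Error part.* Started in `S`, the error remains there. For other initial states, compare it with a
solution of the error system in `S`, to which it is attracted if `A + B K_t` is Schur. This is not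
assumed, but holds (`TubeDesign.Admissible.isSchur_tube`): the modes that the inputs do not reach
are modes of the Schur matrix `A + B K`, and a mode of modulus at least one that the inputs do reach
would be driven out of the bounded set `S` by disturbances in `B Ŵ`.
-/

/-! ### Schur matrices -/

section Schur

attribute [local instance] Matrix.linftyOpNormedRing Matrix.linftyOpNormedAlgebra

theorem IsSchur.spectralRadius_lt_one {n : ℕ} {F : Matrix (Fin n) (Fin n) ℝ} (hF : IsSchur F) :
    spectralRadius ℂ (F.map (algebraMap ℝ ℂ)) < 1 := by
  rcases (spectrum ℂ (F.map (algebraMap ℝ ℂ))).eq_empty_or_nonempty with h | h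
  · rw [spectralRadius, h]
    simp
  · exact spectrum.spectralRadius_lt_of_forall_lt_of_nonempty h fun μ hμ => hF μ hμ

/-- The powers of a Schur matrix decay exponentially, by Gelfand's formula. -/
theorem IsSchur.exists_pow_le {n : ℕ} {F : Matrix (Fin n) (Fin n) ℝ} (hF : IsSchur F) :
    ∃ C ρ : ℝ, 1 ≤ C ∧ 0 < ρ ∧ ρ < 1 ∧ ∀ k x, ‖F ^ k *ᵥ x‖ ≤ C * ρ ^ k * ‖x‖ := by
  set Fc := F.map (algebraMap ℝ ℂ)
  obtain ⟨r, hr, hr1⟩ := ENNReal.lt_iff_exists_nnreal_btwn.1 hF.spectralRadius_lt_one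
  have hr1 : r < 1 := by exact_mod_cast hr1
  have hr0 : (0 : ℝ) < r := by
    have : (0 : ENNReal) < r := lt_of_le_of_lt (zero_le) hr
    exact_mod_cast this
  have hlim := (spectrum.pow_norm_pow_one_div_tendsto_nhds_spectralRadius Fc).eventually_lt_const hr
  obtain ⟨k₀, hk₀⟩ := Filter.eventually_atTop.1 hlim
  have hbound : ∀ k, k₀ ≤ k → 1 ≤ k → ‖Fc ^ k‖ ≤ (r : ℝ) ^ k := by
    intro k hk hk1
    have h := (ENNReal.ofReal_lt_coe_iff (by positivity)).1 (hk₀ k hk)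
    have hk' : (k : ℝ) ≠ 0 := by positivity
    have h2 := pow_le_pow_left₀ (by positivity) h.le k
    rwa [← Real.rpow_natCast, ← Real.rpow_mul (norm_nonneg _), one_div, inv_mul_cancel₀ hk',
      Real.rpow_one] at h2
  have hnorm : ∀ k, ‖F ^ k‖ = ‖Fc ^ k‖ := by
    intro k
    have : Fc ^ k = (F ^ k).map (algebraMap ℝ ℂ) := (Matrix.map_pow F (algebraMap ℝ ℂ) k).symm
    rw [this, Matrix.linfty_opNorm_def, Matrix.linfty_opNorm_def]
    simp
  refine ⟨1 + ∑ k ∈ Finset.range (k₀ + 1), ‖F ^ k‖ / (r : ℝ) ^ k, r, ?_, hr0,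
    by exact_mod_cast hr1, fun k x => ?_⟩
  · have : 0 ≤ ∑ k ∈ Finset.range (k₀ + 1), ‖F ^ k‖ / (r : ℝ) ^ k :=
      Finset.sum_nonneg fun _ _ => by positivity
    linarith
  · refine (Matrix.linfty_opNorm_mulVec _ _).trans
      (mul_le_mul_of_nonneg_right ?_ (norm_nonneg _))
    have hsum : 0 ≤ ∑ k ∈ Finset.range (k₀ + 1), ‖F ^ k‖ / (r : ℝ) ^ k :=
      Finset.sum_nonneg fun _ _ => by positivity
    rcases lt_or_ge k (k₀ + 1) with h | h
    · have := Finset.single_le_sum (f := fun k => ‖F ^ k‖ / (r : ℝ) ^ k)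
        (fun _ _ => by positivity) (Finset.mem_range.2 h)
      rw [← div_le_iff₀ (by positivity)]
      linarith
    · rw [hnorm]
      refine (hbound k (by omega) (by omega)).trans ?_
      have : 0 < (r : ℝ) ^ k := by positivity
      nlinarith

end Schur

theorem mem_spectrum_of_vecMul_eq_smul {n : ℕ} {G : Matrix (Fin n) (Fin n) ℂ} {μ : ℂ}
    {p : Fin n → ℂ} (hp : p ≠ 0) (h : p ᵥ* G = μ • p) : μ ∈ spectrum ℂ G := by
  rw [spectrum.mem_iff, Matrix.isUnit_iff_isUnit_det, isUnit_iff_ne_zero, not_not,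
    ← Matrix.exists_vecMul_eq_zero_iff]
  refine ⟨p, hp, ?_⟩
  rw [Matrix.vecMul_sub, h, Matrix.algebraMap_eq_diagonal]
  ext i
  simp [Matrix.vecMul_diagonal, mul_comm]

theorem exists_vecMul_eq_smul {n : ℕ} {G : Matrix (Fin n) (Fin n) ℂ} {μ : ℂ}
    (h : μ ∈ spectrum ℂ G) : ∃ p : Fin n → ℂ, p ≠ 0 ∧ p ᵥ* G = μ • p := by
  rw [spectrum.mem_iff, Matrix.isUnit_iff_isUnit_det, isUnit_iff_ne_zero, not_not,
    ← Matrix.exists_vecMul_eq_zero_iff] at h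
  obtain ⟨p, hp, h⟩ := h
  refine ⟨p, hp, ?_⟩
  rw [Matrix.vecMul_sub, sub_eq_zero, Matrix.algebraMap_eq_diagonal] at h
  rw [← h]
  ext i
  simp [Matrix.vecMul_diagonal, mul_comm]

/-- If some feedback `u = L x` makes `x⁺ = F x + B u` Schur, and a nonempty bounded set is robustly
invariant for `x⁺ = F x + B u` under all small inputs `u`, then `F` itself is Schur: inputs excite
every mode that they reach, and the feedback cannot move the modes that they do not reach. -/
theorem IsSchur.of_bounded_robustInvariant {n m : ℕ} {F : Matrix (Fin n) (Fin n) ℝ}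
    {B : Matrix (Fin n) (Fin m) ℝ} {L : Matrix (Fin m) (Fin n) ℝ} (hL : IsSchur (F + B * L))
    {S : Set (Fin n → ℝ)} (hS : Bornology.IsBounded S) (hne : S.Nonempty) {ε : ℝ} (hε : 0 < ε)
    (hinv : ∀ x ∈ S, ∀ u, ‖u‖ ≤ ε → F *ᵥ x + B *ᵥ u ∈ S) : IsSchur F := by
  intro μ hμ
  by_contra hμ1
  rw [not_lt] at hμ1
  obtain ⟨p, hp, hpF⟩ := exists_vecMul_eq_smul hμ
  -- the left eigenvector as a functional on real vectors
  set φ : (Fin n → ℝ) → ℂ := fun x => p ⬝ᵥ (fun i => (x i : ℂ)) with hφ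
  have hφadd : ∀ x y, φ (x + y) = φ x + φ y := fun x y => by
    simp [hφ, dotProduct, mul_add, Finset.sum_add_distrib]
  have hφmul : ∀ {l : ℕ} (M : Matrix (Fin n) (Fin l) ℝ) (x : Fin l → ℝ),
      φ (M *ᵥ x) = (p ᵥ* M.map (algebraMap ℝ ℂ)) ⬝ᵥ fun i => (x i : ℂ) := by
    intro l M x
    rw [← Matrix.dotProduct_mulVec]
    simp [hφ, Matrix.mulVec, dotProduct]
  have hφF : ∀ x, φ (F *ᵥ x) = μ * φ x := fun x => by
    rw [hφmul, hpF, smul_dotProduct, smul_eq_mul]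
  by_cases hpB : p ᵥ* B.map (algebraMap ℝ ℂ) = 0
  · refine absurd (hL μ (mem_spectrum_of_vecMul_eq_smul hp ?_)) (not_lt.2 hμ1)
    have : (F + B * L).map (algebraMap ℝ ℂ) = F.map (algebraMap ℝ ℂ)
        + B.map (algebraMap ℝ ℂ) * L.map (algebraMap ℝ ℂ) := by
      rw [Matrix.map_add _ (map_add _), Matrix.map_mul]
    rw [this, Matrix.vecMul_add, ← Matrix.vecMul_vecMul, hpB, hpF]
    simp
  obtain ⟨j, hj⟩ := Function.ne_iff.1 hpB
  set β := (p ᵥ* B.map (algebraMap ℝ ℂ)) j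
  have hβ : 0 < ‖β‖ := norm_pos_iff.2 hj
  have hφB : ∀ t : ℝ, φ (B *ᵥ Pi.single j t) = t * β := fun t => by
    rw [hφmul, dotProduct, Finset.sum_eq_single j]
    · simp [β, mul_comm]
    · intro b _ hb
      simp [hb]
    · simp
  obtain ⟨M, hM⟩ : ∃ M, ∀ x ∈ S, ‖φ x‖ ≤ M := by
    have hc : Continuous φ := by
      simp only [hφ, dotProduct]
      fun_prop
    obtain ⟨M, hM⟩ := (hS.isCompact_closure.image hc).isBounded.exists_norm_le
    exact ⟨M, fun x hx => hM _ ⟨x, subset_closure hx, rfl⟩⟩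
  obtain ⟨s, hs⟩ := hne
  have hreach : ∀ (k : ℕ) (t : ℕ → ℝ), (∀ l, |t l| ≤ ε) →
      ∃ x ∈ S, φ x = μ ^ k * φ s + ∑ l ∈ Finset.range k, μ ^ l * (t l * β) := by
    intro k
    induction k with
    | zero => exact fun t _ => ⟨s, hs, by simp⟩
    | succ k ih =>
      intro t ht
      obtain ⟨x, hx, hxφ⟩ := ih (fun l => t (l + 1)) fun l => ht _
      refine ⟨_, hinv x hx (Pi.single j (t 0)) ?_, ?_⟩
      · rw [Pi.norm_single]
        exact ht 0
      · rw [hφadd, hφF, hφB, hxφ, Finset.sum_range_succ', mul_add, Finset.mul_sum]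
        simp only [pow_succ, pow_zero]
        rw [add_assoc, one_mul]
        congr 1
        · ring
        · congr 1
          exact Finset.sum_congr rfl fun l _ => by ring
  have hsum : ∀ (k : ℕ) (t : ℕ → ℝ), (∀ l, |t l| ≤ ε) →
      ‖∑ l ∈ Finset.range k, μ ^ l * (t l * β)‖ ≤ 2 * M := by
    intro k t ht
    obtain ⟨x, hx, hxφ⟩ := hreach k t ht
    obtain ⟨y, hy, hyφ⟩ := hreach k 0 fun l => by simpa using hε.le
    have : ∑ l ∈ Finset.range k, μ ^ l * (t l * β) = φ x - φ y := by
      rw [hxφ, hyφ]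
      simp
    rw [this]
    linarith [norm_sub_le (φ x) (φ y), hM x hx, hM y hy]
  have hsign : ∀ a : ℝ, |ε * (SignType.sign a : ℝ)| ≤ ε := fun a => by
    rw [abs_mul, abs_of_pos hε]
    rcases lt_trichotomy a 0 with h | h | h <;> simp [h, hε.le]
  -- the signs of the inputs align the real parts, respectively the imaginary parts
  have hre : ∀ k, ε * ∑ l ∈ Finset.range k, |(μ ^ l * β).re| ≤ 2 * M := fun k => by
    refine le_trans (le_of_eq ?_) ((Complex.re_le_norm _).trans
      (hsum k (fun l => ε * SignType.sign (μ ^ l * β).re) fun l => hsign _))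
    rw [Complex.re_sum, Finset.mul_sum]
    refine Finset.sum_congr rfl fun l _ => ?_
    rw [mul_left_comm, Complex.re_ofReal_mul, mul_assoc, sign_mul_self]
  have him : ∀ k, ε * ∑ l ∈ Finset.range k, |(μ ^ l * β).im| ≤ 2 * M := fun k => by
    refine le_trans (le_of_eq ?_) ((Complex.im_le_norm _).trans
      (hsum k (fun l => ε * SignType.sign (μ ^ l * β).im) fun l => hsign _))
    rw [Complex.im_sum, Finset.mul_sum]
    refine Finset.sum_congr rfl fun l _ => ?_
    rw [mul_left_comm, Complex.im_ofReal_mul, mul_assoc, sign_mul_self]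
  obtain ⟨k, hk⟩ := exists_nat_gt (4 * M / (ε * ‖β‖))
  rw [div_lt_iff₀ (by positivity)] at hk
  have hlow : k * ‖β‖ ≤ ∑ l ∈ Finset.range k, |(μ ^ l * β).re|
      + ∑ l ∈ Finset.range k, |(μ ^ l * β).im| := by
    rw [← Finset.sum_add_distrib, ← nsmul_eq_mul]
    nth_rewrite 1 [← Finset.card_range k]
    refine Finset.card_nsmul_le_sum _ _ _ fun l _ =>
      le_trans ?_ (Complex.norm_le_abs_re_add_abs_im _)
    rw [norm_mul, norm_pow]
    exact le_mul_of_one_le_left hβ.le (one_le_pow₀ hμ1)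
  nlinarith [hre k, him k, mul_le_mul_of_nonneg_left hlow hε.le]

/-! ### Quadratic forms -/

theorem continuous_quadForm {n : ℕ} (Q : Matrix (Fin n) (Fin n) ℝ) : Continuous (quadForm Q) := by
  unfold quadForm
  fun_prop

theorem quadForm_smul {n : ℕ} (Q : Matrix (Fin n) (Fin n) ℝ) (t : ℝ) (x : Fin n → ℝ) :
    quadForm Q (t • x) = t ^ 2 * quadForm Q x := by
  simp only [quadForm, Matrix.mulVec_smul, dotProduct_smul, smul_dotProduct, smul_eq_mul]
  ring

/-- The parallelogram law. -/
theorem quadForm_midpoint {n : ℕ} (Q : Matrix (Fin n) (Fin n) ℝ) (x y : Fin n → ℝ) :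
    quadForm Q ((2⁻¹ : ℝ) • (x + y)) =
      (quadForm Q x + quadForm Q y) / 2 - quadForm Q (x - y) / 4 := by
  rw [quadForm_smul]
  simp only [quadForm, Matrix.mulVec_add, Matrix.mulVec_sub, dotProduct_add, add_dotProduct,
    dotProduct_sub, sub_dotProduct]
  ring

theorem exists_quadForm_le {n : ℕ} (Q : Matrix (Fin n) (Fin n) ℝ) :
    ∃ C, 0 ≤ C ∧ ∀ x, quadForm Q x ≤ C * ‖x‖ ^ 2 := by
  obtain ⟨C, hC⟩ := ((isCompact_closedBall (0 : Fin n → ℝ) 1).image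
    (continuous_quadForm Q)).isBounded.exists_norm_le
  have hC0 : 0 ≤ C := (norm_nonneg _).trans (hC _ ⟨0, by simp, rfl⟩)
  refine ⟨C, hC0, fun x => ?_⟩
  have h := (le_abs_self _).trans (hC _ ⟨‖x‖⁻¹ • x, ?_, rfl⟩)
  · rcases eq_or_ne x 0 with rfl | hx
    · simp [quadForm]
    · have hx' : 0 < ‖x‖ := norm_pos_iff.2 hx
      rw [quadForm_smul, inv_pow, inv_mul_le_iff₀ (by positivity)] at h
      linarith
  · rw [mem_closedBall_zero_iff, norm_smul, norm_inv, norm_norm]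
    exact inv_mul_le_one

theorem Matrix.PosSemidef.quadForm_nonneg {n : ℕ} {Q : Matrix (Fin n) (Fin n) ℝ}
    (hQ : Q.PosSemidef) (x : Fin n → ℝ) : 0 ≤ quadForm Q x := by
  simpa [quadForm] using hQ.dotProduct_mulVec_nonneg x

theorem Matrix.PosDef.exists_le_quadForm {n : ℕ} {R : Matrix (Fin n) (Fin n) ℝ}
    (hR : R.PosDef) : ∃ r, 0 < r ∧ ∀ x, r * ‖x‖ ^ 2 ≤ quadForm R x := by
  have hpos : ∀ x ≠ 0, 0 < quadForm R x := fun x hx => by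
    simpa [quadForm] using hR.dotProduct_mulVec_pos hx
  rcases (Metric.sphere (0 : Fin n → ℝ) 1).eq_empty_or_nonempty with h | h
  · refine ⟨1, one_pos, fun x => ?_⟩
    rcases eq_or_ne x 0 with rfl | hx
    · simp [quadForm]
    · refine absurd (Set.mem_empty_iff_false (‖x‖⁻¹ • x)).1 ?_
      rw [← h, mem_sphere_zero_iff_norm, norm_smul, norm_inv, norm_norm]
      simp [hx]
  · obtain ⟨y, hy, hmin⟩ := (isCompact_sphere _ _).exists_isMinOn h
      (continuous_quadForm R).continuousOn
    have hy0 : y ≠ 0 := by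
      rintro rfl
      simp at hy
    refine ⟨quadForm R y, hpos y hy0, fun x => ?_⟩
    rcases eq_or_ne x 0 with rfl | hx
    · simp [quadForm]
    · have hx' : 0 < ‖x‖ := norm_pos_iff.2 hx
      have := hmin (a := ‖x‖⁻¹ • x) (by
        rw [mem_sphere_zero_iff_norm, norm_smul, norm_inv, norm_norm]
        exact inv_mul_cancel₀ hx'.ne')
      rw [Set.mem_ofPred_eq, quadForm_smul, inv_pow, le_inv_mul_iff₀ (by positivity)] at this
      linarith

theorem exists_norm_mulVec_le {l k : ℕ} (M : Matrix (Fin l) (Fin k) ℝ) :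
    ∃ C, 0 ≤ C ∧ ∀ x, ‖M *ᵥ x‖ ≤ C * ‖x‖ :=
  ⟨‖LinearMap.toContinuousLinearMap M.mulVecLin‖, norm_nonneg _,
    (LinearMap.toContinuousLinearMap M.mulVecLin).le_opNorm⟩

/-! ### Predictions -/

section Predict

variable {n m : ℕ} (A : Matrix (Fin n) (Fin n) ℝ) (B : Matrix (Fin n) (Fin m) ℝ)

theorem predict_congr (z : Fin n → ℝ) {v v' : ℕ → Fin m → ℝ} :
    ∀ {k : ℕ}, (∀ l < k, v l = v' l) → predict A B z v k = predict A B z v' k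
  | 0, _ => rfl
  | k + 1, h => by
    rw [predict, predict, predict_congr z fun l hl => h l (by omega), h k (by omega)]

theorem predict_succ' (z : Fin n → ℝ) (v : ℕ → Fin m → ℝ) (k : ℕ) :
    predict A B z v (k + 1) = predict A B (A *ᵥ z + B *ᵥ v 0) (fun l => v (l + 1)) k := by
  induction k with
  | zero => rfl
  | succ k ih => rw [predict, ih, predict]

theorem predict_sub (z z' : Fin n → ℝ) (v v' : ℕ → Fin m → ℝ) (k : ℕ) :
    predict A B (z - z') (v - v') k = predict A B z v k - predict A B z' v' k := by
  induction k with
  | zero => rfl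
  | succ k ih =>
    simp only [predict, ih, Pi.sub_apply, Matrix.mulVec_sub]
    abel

theorem predict_midpoint (z : Fin n → ℝ) (v v' : ℕ → Fin m → ℝ) (k : ℕ) :
    predict A B z ((2⁻¹ : ℝ) • (v + v')) k
      = (2⁻¹ : ℝ) • (predict A B z v k + predict A B z v' k) := by
  induction k with
  | zero =>
    simp only [predict]
    rw [← two_smul ℝ z, smul_smul]
    norm_num
  | succ k ih =>
    rw [predict, ih, predict, predict]
    simp only [Pi.smul_apply, Pi.add_apply, Matrix.mulVec_smul, Matrix.mulVec_add, smul_add]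
    abel

theorem exists_norm_predict_le (N : ℕ) :
    ∃ C, 0 ≤ C ∧ ∀ k ≤ N, ∀ z v,
      ‖predict A B z v k‖ ≤ C * (‖z‖ + ∑ l ∈ Finset.range N, ‖v l‖) := by
  obtain ⟨a, ha, hA⟩ := exists_norm_mulVec_le A
  obtain ⟨b, hb, hB⟩ := exists_norm_mulVec_le B
  have key : ∀ j, ∃ C, 0 ≤ C ∧ ∀ k ≤ j, k ≤ N → ∀ z v,
      ‖predict A B z v k‖ ≤ C * (‖z‖ + ∑ l ∈ Finset.range N, ‖v l‖) := by
    intro j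
    induction j with
    | zero =>
      refine ⟨1, zero_le_one, fun k hk _ z v => ?_⟩
      obtain rfl : k = 0 := by omega
      have : 0 ≤ ∑ l ∈ Finset.range N, ‖v l‖ := Finset.sum_nonneg fun _ _ => norm_nonneg _
      simp only [predict]
      linarith
    | succ j ih =>
      obtain ⟨C, hC, h⟩ := ih
      refine ⟨C + (a * C + b), by positivity, fun k hk hkN z v => ?_⟩
      have hs : 0 ≤ ∑ l ∈ Finset.range N, ‖v l‖ := Finset.sum_nonneg fun _ _ => norm_nonneg _
      rw [add_mul]
      rcases Nat.le_succ_iff.1 hk with hk | rfl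
      · have : 0 ≤ (a * C + b) * (‖z‖ + ∑ l ∈ Finset.range N, ‖v l‖) := by positivity
        linarith [h k hk hkN z v]
      · have h1 := h j le_rfl (by omega) z v
        have h2 : ‖v j‖ ≤ ∑ l ∈ Finset.range N, ‖v l‖ :=
          Finset.single_le_sum (f := fun l => ‖v l‖) (fun _ _ => norm_nonneg _)
            (Finset.mem_range.2 (by omega))
        have h3 : ‖predict A B z v (j + 1)‖ ≤ a * ‖predict A B z v j‖ + b * ‖v j‖ :=
          (norm_add_le _ _).trans (add_le_add (hA _) (hB _))
        nlinarith [mul_le_mul_of_nonneg_left h1 ha, mul_le_mul_of_nonneg_left h2 hb,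
          mul_nonneg hb (norm_nonneg z), mul_nonneg hC (norm_nonneg z), mul_nonneg hC hs]
  obtain ⟨C, hC, h⟩ := key N
  exact ⟨C, hC, fun k hk => h k hk hk⟩

end Predict

/-! ### Pontryagin differences -/

theorem Convex.pontryaginDiff {n : ℕ} {C : Set (Fin n → ℝ)} (hC : Convex ℝ C)
    (T : Set (Fin n → ℝ)) : Convex ℝ (pontryaginDiff C T) := by
  intro x hx y hy a b ha hb hab d hd
  have := hC (hx d hd) (hy d hd) ha hb hab
  rwa [smul_add, smul_add, add_add_add_comm, ← add_smul, hab, one_smul] at this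

theorem isBounded_pontryaginDiff {n : ℕ} {C T : Set (Fin n → ℝ)} (hC : Bornology.IsBounded C)
    (hT : T.Nonempty) : Bornology.IsBounded (pontryaginDiff C T) := by
  obtain ⟨d, hd⟩ := hT
  obtain ⟨M, hM⟩ := hC.exists_norm_le
  refine isBounded_iff_forall_norm_le.2 ⟨M + ‖d‖, fun y hy => ?_⟩
  have h : ‖y + d - d‖ ≤ _ := norm_sub_le _ _
  rw [add_sub_cancel_right] at h
  linarith [hM _ (hy d hd)]

theorem Convex.half_smul_add_mem {E : Type*} [AddCommGroup E] [Module ℝ E] {C : Set E}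
    (hC : Convex ℝ C) {x y : E} (hx : x ∈ C) (hy : y ∈ C) : (2⁻¹ : ℝ) • (x + y) ∈ C := by
  rw [smul_add]
  exact hC hx hy (by norm_num) (by norm_num) (by norm_num)

/-! ### The finite-horizon problem -/

namespace TubeDesign

variable {n m : ℕ} {D : TubeDesign n m} {p : ControlProblem n m}

/-- The closed-loop matrix `A + B K` of the nominal system under the terminal controller. -/
noncomputable def AK (D : TubeDesign n m) : Matrix (Fin n) (Fin n) ℝ := D.A + D.B * D.K

theorem AK_mulVec (D : TubeDesign n m) (x : Fin n → ℝ) :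
    D.AK *ᵥ x = D.A *ᵥ x + D.B *ᵥ (D.K *ᵥ x) := by
  rw [AK, Matrix.add_mulVec, Matrix.mulVec_mulVec]

/-- The candidate input sequence at the successor state: `v` without its first element, followed
by the terminal controller at the predicted terminal state. -/
noncomputable def shifted (D : TubeDesign n m) (N : ℕ) (z : Fin n → ℝ)
    (v : ℕ → Fin m → ℝ) : ℕ → Fin m → ℝ :=
  fun k => if k + 1 < N then v (k + 1) else D.K *ᵥ predict D.A D.B z v N

theorem predict_shifted (D : TubeDesign n m) {N k : ℕ} (hk : k < N) (z : Fin n → ℝ)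
    (v : ℕ → Fin m → ℝ) :
    predict D.A D.B (D.A *ᵥ z + D.B *ᵥ v 0) (D.shifted N z v) k = predict D.A D.B z v (k + 1) := by
  rw [predict_succ']
  exact predict_congr _ _ _ fun l hl => if_pos (by omega)

theorem predict_shifted_last (D : TubeDesign n m) {N : ℕ} (hN : 0 < N) (z : Fin n → ℝ)
    (v : ℕ → Fin m → ℝ) :
    predict D.A D.B (D.A *ᵥ z + D.B *ᵥ v 0) (D.shifted N z v) N
      = D.AK *ᵥ predict D.A D.B z v N := by
  obtain ⟨N, rfl⟩ : ∃ M, N = M + 1 := ⟨N - 1, by omega⟩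
  rw [predict, D.predict_shifted (Nat.lt_succ_self N), AK_mulVec]
  simp [shifted]

theorem Admissible.AK_mem (hD : D.Admissible p) {x : Fin n → ℝ} (hx : x ∈ D.Zf) :
    D.AK *ᵥ x ∈ D.Zf :=
  hD.pi_Zf ⟨x, hx, rfl⟩

theorem Admissible.K_mem (hD : D.Admissible p) {x : Fin n → ℝ} (hx : x ∈ D.Zf) :
    D.K *ᵥ x ∈ D.V p :=
  hD.K_Zf_sub ⟨x, hx, rfl⟩

theorem IsFeasible.shifted (hD : D.Admissible p) (hN : 0 < p.N) {z : Fin n → ℝ}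
    {v : ℕ → Fin m → ℝ} (h : D.IsFeasible p z v) :
    D.IsFeasible p (D.A *ᵥ z + D.B *ᵥ v 0) (D.shifted p.N z v) := by
  refine ⟨fun k hk => ⟨?_, ?_⟩, ?_⟩
  · rw [D.predict_shifted hk]
    rcases Nat.lt_or_ge (k + 1) p.N with h' | h'
    · exact (h.1 _ h').1
    · rw [show k + 1 = p.N by omega]
      exact hD.Zf_sub h.2
  · unfold TubeDesign.shifted
    split_ifs with h'
    · exact (h.1 _ h').2
    · exact hD.K_mem h.2
  · rw [D.predict_shifted_last hN]
    exact hD.AK_mem h.2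

theorem IsFeasible.midpoint (hp : p.Standing) (hD : D.Admissible p) {z : Fin n → ℝ}
    {v v' : ℕ → Fin m → ℝ} (h : D.IsFeasible p z v) (h' : D.IsFeasible p z v') :
    D.IsFeasible p z ((2⁻¹ : ℝ) • (v + v')) := by
  refine ⟨fun k hk => ⟨?_, ?_⟩, ?_⟩
  · rw [predict_midpoint]
    exact (hp.convex_X.pontryaginDiff _).half_smul_add_mem (h.1 k hk).1 (h'.1 k hk).1
  · exact ((hp.convex_U.smul _).pontryaginDiff _).half_smul_add_mem (h.1 k hk).2 (h'.1 k hk).2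
  · rw [predict_midpoint]
    exact hD.convex_Zf.half_smul_add_mem h.2 h'.2

theorem cost_midpoint (D : TubeDesign n m) (p : ControlProblem n m) (z : Fin n → ℝ)
    (v v' : ℕ → Fin m → ℝ) :
    D.cost p z ((2⁻¹ : ℝ) • (v + v'))
      = (D.cost p z v + D.cost p z v') / 2 - D.cost p 0 (v - v') / 4 := by
  have h : ∀ k, predict D.A D.B 0 (v - v') k = predict D.A D.B z v k - predict D.A D.B z v' k := by
    intro k
    rw [← predict_sub, sub_self]
  simp only [cost, predict_midpoint, h, Pi.smul_apply, Pi.add_apply, Pi.sub_apply,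
    quadForm_midpoint]
  have hs : ∀ a b c d e f : ℕ → ℝ, ∑ k ∈ Finset.range p.N,
      ((a k + b k) / 2 - c k / 4 + ((d k + e k) / 2 - f k / 4))
      = (∑ k ∈ Finset.range p.N, (a k + d k) + ∑ k ∈ Finset.range p.N, (b k + e k)) / 2
        - (∑ k ∈ Finset.range p.N, (c k + f k)) / 4 := by
    intro a b c d e f
    rw [← Finset.sum_add_distrib, Finset.sum_div, Finset.sum_div, ← Finset.sum_sub_distrib]
    exact Finset.sum_congr rfl fun k _ => by ring
  rw [hs]
  ring

/-- Optimal sequences minimize a strongly convex cost over a convex set, so the cost grows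
quadratically away from them. -/
theorem IsOptimal.cost_add_le (hp : p.Standing) (hD : D.Admissible p) {z : Fin n → ℝ}
    {v v' : ℕ → Fin m → ℝ} (h : D.IsOptimal p z v) (h' : D.IsFeasible p z v') :
    D.cost p z v + D.cost p 0 (v - v') / 2 ≤ D.cost p z v' := by
  have := h.2 _ (h.1.midpoint hp hD h')
  rw [cost_midpoint] at this
  linarith

theorem Admissible.quadForm_AK_le (hD : D.Admissible p) (x : Fin n → ℝ) :
    quadForm D.P (D.AK *ᵥ x) + (quadForm p.Q x + quadForm p.R (D.K *ᵥ x)) ≤ quadForm D.P x := by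
  have h := hD.lyap.quadForm_nonneg x
  have hc : ∀ {l : ℕ} (M : Matrix (Fin l) (Fin l) ℝ) (T : Matrix (Fin l) (Fin n) ℝ),
      x ⬝ᵥ ((Tᵀ * M * T) *ᵥ x) = (T *ᵥ x) ⬝ᵥ (M *ᵥ (T *ᵥ x)) := by
    intro l M T
    rw [Matrix.mul_assoc, ← Matrix.mulVec_mulVec, ← Matrix.mulVec_mulVec,
      Matrix.dotProduct_mulVec, Matrix.vecMul_transpose]
  simp only [quadForm, Matrix.sub_mulVec, Matrix.add_mulVec _ _ x, dotProduct_sub,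
    dotProduct_add, hc] at h
  simp only [quadForm, AK, Matrix.add_mulVec]
  linarith

theorem Admissible.quadForm_P_nonneg (hp : p.Standing) (hD : D.Admissible p) (x : Fin n → ℝ) :
    0 ≤ quadForm D.P x := by
  obtain ⟨C, ρ, hC, hρ, hρ1, h⟩ := hD.schur_K.exists_pow_le
  have hlim : Filter.Tendsto (fun k => D.AK ^ k *ᵥ x) Filter.atTop (nhds 0) := by
    refine squeeze_zero_norm (fun k => h k x) ?_
    simpa using ((tendsto_pow_atTop_nhds_zero_of_lt_one hρ.le hρ1).const_mul C).mul_const ‖x‖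
  have hlim' := ((continuous_quadForm D.P).tendsto 0).comp hlim
  have h0 : quadForm D.P 0 = 0 := by simp [quadForm]
  rw [h0] at hlim'
  refine le_of_tendsto' hlim' fun k => ?_
  induction k with
  | zero => simp
  | succ k ih =>
    refine le_trans ?_ ih
    have h1 := hD.quadForm_AK_le (D.AK ^ k *ᵥ x)
    have h2 := hp.Q_psd.quadForm_nonneg (D.AK ^ k *ᵥ x)
    have h3 := hp.R_pd.posSemidef.quadForm_nonneg (D.K *ᵥ (D.AK ^ k *ᵥ x))
    rw [Function.comp_apply, Function.comp_apply, pow_succ', ← Matrix.mulVec_mulVec]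
    linarith

/-- The stage and terminal costs dominate the squared size of the inputs. -/
theorem Admissible.exists_le_cost (hp : p.Standing) (hD : D.Admissible p) :
    ∃ r, 0 < r ∧ ∀ z v,
      r * (∑ k ∈ Finset.range p.N, ‖v k‖) ^ 2 ≤ D.cost p z v := by
  obtain ⟨r, hr, hR⟩ := hp.R_pd.exists_le_quadForm
  have hN : (0 : ℝ) < p.N := by exact_mod_cast hp.N_pos
  have hle : ∀ z v, ∑ k ∈ Finset.range p.N, quadForm p.R (v k) ≤ D.cost p z v := by
    intro z v
    have h1 : ∑ k ∈ Finset.range p.N, quadForm p.R (v k) ≤ ∑ k ∈ Finset.range p.N,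
        (quadForm p.Q (predict D.A D.B z v k) + quadForm p.R (v k)) :=
      Finset.sum_le_sum fun k _ => by linarith [hp.Q_psd.quadForm_nonneg (predict D.A D.B z v k)]
    unfold cost
    linarith [hD.quadForm_P_nonneg hp (predict D.A D.B z v p.N)]
  refine ⟨r / p.N, by positivity, fun z v => ?_⟩
  refine le_trans ?_ (hle z v)
  rw [div_mul_eq_mul_div, div_le_iff₀ hN]
  have h1 := sq_sum_le_card_mul_sum_sq (s := Finset.range p.N) (f := fun k => ‖v k‖)
  have h2 : r * ∑ k ∈ Finset.range p.N, ‖v k‖ ^ 2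
      ≤ ∑ k ∈ Finset.range p.N, quadForm p.R (v k) := by
    rw [Finset.mul_sum]
    exact Finset.sum_le_sum fun k _ => hR _
  rw [Finset.card_range] at h1
  nlinarith

/-- The terminal inequality makes the candidate sequence at most as costly. -/
theorem Admissible.cost_shifted_le (hp : p.Standing) (hD : D.Admissible p) (z : Fin n → ℝ)
    (v : ℕ → Fin m → ℝ) :
    D.cost p (D.A *ᵥ z + D.B *ᵥ v 0) (D.shifted p.N z v) ≤ D.cost p z v := by
  have hN := hp.N_pos
  have h1 : ∑ k ∈ Finset.range p.N, (quadForm p.Q (predict D.A D.B (D.A *ᵥ z + D.B *ᵥ v 0)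
      (D.shifted p.N z v) k) + quadForm p.R (D.shifted p.N z v k))
      = ∑ k ∈ Finset.range p.N, (quadForm p.Q (predict D.A D.B z v (k + 1))
        + quadForm p.R (D.shifted p.N z v k)) :=
    Finset.sum_congr rfl fun k hk => by rw [D.predict_shifted (Finset.mem_range.1 hk)]
  rw [cost, cost, h1, D.predict_shifted_last hN]
  obtain ⟨N, hN'⟩ : ∃ M, p.N = M + 1 := ⟨p.N - 1, by omega⟩
  rw [hN', Finset.sum_range_succ, Finset.sum_range_succ' (n := N)]
  have h2 : ∑ k ∈ Finset.range N, (quadForm p.Q (predict D.A D.B z v (k + 1))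
      + quadForm p.R (D.shifted (N + 1) z v k))
      = ∑ k ∈ Finset.range N, (quadForm p.Q (predict D.A D.B z v (k + 1))
        + quadForm p.R (v (k + 1))) :=
    Finset.sum_congr rfl fun k hk => by
      rw [shifted, if_pos (by have := Finset.mem_range.1 hk; omega)]
  have h3 : D.shifted (N + 1) z v N = D.K *ᵥ predict D.A D.B z v (N + 1) := by simp [shifted]
  rw [h2, h3]
  have := hD.quadForm_AK_le (predict D.A D.B z v (N + 1))
  have h4 := hp.Q_psd.quadForm_nonneg (predict D.A D.B z v 0)
  have h5 := hp.R_pd.posSemidef.quadForm_nonneg (v 0)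
  linarith

/-- In the terminal set, the terminal controller is feasible and costs at most `‖z‖²_P`. -/
theorem Admissible.exists_feasible_cost_le (hD : D.Admissible p) {z : Fin n → ℝ}
    (hz : z ∈ D.Zf) : ∃ v, D.IsFeasible p z v ∧ D.cost p z v ≤ quadForm D.P z := by
  have hmem : ∀ k, D.AK ^ k *ᵥ z ∈ D.Zf := by
    intro k
    induction k with
    | zero => simpa using hz
    | succ k ih =>
      rw [pow_succ', ← Matrix.mulVec_mulVec]
      exact hD.AK_mem ih
  have hpred : ∀ k, predict D.A D.B z (fun k => D.K *ᵥ (D.AK ^ k *ᵥ z)) k = D.AK ^ k *ᵥ z := by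
    intro k
    induction k with
    | zero => simp [predict]
    | succ k ih => rw [predict, ih, pow_succ', ← Matrix.mulVec_mulVec, AK_mulVec]
  refine ⟨fun k => D.K *ᵥ (D.AK ^ k *ᵥ z), ⟨fun k _ => ?_, ?_⟩, ?_⟩
  · rw [hpred]
    exact ⟨hD.Zf_sub (hmem k), hD.K_mem (hmem k)⟩
  · rw [hpred]
    exact hmem _
  · simp only [cost, hpred]
    induction p.N with
    | zero => simp
    | succ k ih =>
      rw [Finset.sum_range_succ, pow_succ', ← Matrix.mulVec_mulVec]
      linarith [hD.quadForm_AK_le (D.AK ^ k *ᵥ z)]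

theorem Admissible.isBounded_Z (hp : p.Standing) (hD : D.Admissible p) :
    Bornology.IsBounded (D.Z p) :=
  isBounded_pontryaginDiff hp.pc_X.1.isBounded hD.nonempty_S

theorem Admissible.isBounded_V (hp : p.Standing) (hD : D.Admissible p) :
    Bornology.IsBounded (D.V p) :=
  isBounded_pontryaginDiff (hp.pc_U.1.isBounded.smul₀ _) (hD.nonempty_S.image _)

theorem Admissible.exists_feasible_cost_bound (hp : p.Standing) (hD : D.Admissible p) :
    ∃ C, 0 ≤ C ∧ ∀ z v, D.IsFeasible p z v → D.cost p z v ≤ C := by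
  obtain ⟨q, hq, hQ⟩ := exists_quadForm_le p.Q
  obtain ⟨r, hr, hR⟩ := exists_quadForm_le p.R
  obtain ⟨t, ht, hP⟩ := exists_quadForm_le D.P
  obtain ⟨a, ha0, ha⟩ := (hD.isBounded_Z hp).exists_pos_norm_le
  obtain ⟨b, hb0, hb⟩ := (hD.isBounded_V hp).exists_pos_norm_le
  refine ⟨p.N * (q * a ^ 2 + r * b ^ 2) + t * a ^ 2, by positivity, fun z v h => ?_⟩
  have hz : ∀ x ∈ D.Z p, ‖x‖ ^ 2 ≤ a ^ 2 := fun x hx => by gcongr; exact ha x hx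
  refine add_le_add ?_ ((hP _).trans (mul_le_mul_of_nonneg_left (hz _ (hD.Zf_sub h.2)) ht))
  rw [← nsmul_eq_mul]
  nth_rewrite 2 [← Finset.card_range p.N]
  refine Finset.sum_le_card_nsmul _ _ _ fun k hk => ?_
  have hk := h.1 k (Finset.mem_range.1 hk)
  have hv : ‖v k‖ ^ 2 ≤ b ^ 2 := by gcongr; exact hb _ hk.2
  exact add_le_add ((hQ _).trans (mul_le_mul_of_nonneg_left (hz _ hk.1) hq))
    ((hR _).trans (mul_le_mul_of_nonneg_left hv hr))

/-- Near the origin the terminal controller gives a quadratic bound on the optimal cost; away from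
the origin boundedness of the constraint sets does. -/
theorem Admissible.exists_optimal_cost_le (hp : p.Standing) (hD : D.Admissible p) :
    ∃ C, 0 ≤ C ∧ ∀ z v, D.IsOptimal p z v → D.cost p z v ≤ C * ‖z‖ ^ 2 := by
  obtain ⟨M, hM0, hM⟩ := hD.exists_feasible_cost_bound hp
  obtain ⟨t, ht, hP⟩ := exists_quadForm_le D.P
  obtain ⟨ε, hε, hball⟩ := Metric.mem_nhds_iff.1 (mem_interior_iff_mem_nhds.1 hD.pc_Zf.2)
  refine ⟨t + M / ε ^ 2, by positivity, fun z v h => ?_⟩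
  rw [add_mul]
  rcases lt_or_ge ‖z‖ ε with hz | hz
  · obtain ⟨v', hv', hc⟩ := hD.exists_feasible_cost_le (hball (mem_ball_zero_iff.2 hz))
    have : 0 ≤ M / ε ^ 2 * ‖z‖ ^ 2 := by positivity
    linarith [h.2 v' hv', hP z]
  · have h1 : M ≤ M / ε ^ 2 * ‖z‖ ^ 2 := by
      rw [div_mul_eq_mul_div, le_div_iff₀ (by positivity)]
      gcongr
    have : 0 ≤ t * ‖z‖ ^ 2 := by positivity
    linarith [hM z v h.1]

end TubeDesign

/-! ### Exponential stability of the nominal closed loop -/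

namespace TubeDesign

variable {n m : ℕ} {D : TubeDesign n m} {p : ControlProblem n m}

/-- The predicted states, continued beyond the horizon `N` by the terminal controller. -/
noncomputable def prediction (D : TubeDesign n m) (N : ℕ) (z : Fin n → ℝ)
    (v : ℕ → Fin m → ℝ) (k : ℕ) : Fin n → ℝ :=
  D.AK ^ (k - N) *ᵥ predict D.A D.B z v (min k N)

theorem prediction_zero (D : TubeDesign n m) (N : ℕ) (z : Fin n → ℝ) (v : ℕ → Fin m → ℝ) :
    D.prediction N z v 0 = z := by
  simp [prediction, predict]

theorem prediction_sub (D : TubeDesign n m) (N : ℕ) (z z' : Fin n → ℝ) (v v' : ℕ → Fin m → ℝ)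
    (k : ℕ) :
    D.prediction N (z - z') (v - v') k = D.prediction N z v k - D.prediction N z' v' k := by
  rw [prediction, predict_sub, Matrix.mulVec_sub, prediction, prediction]

/-- The candidate sequence shifts the whole infinite prediction by one step. -/
theorem prediction_shifted (D : TubeDesign n m) {N : ℕ} (hN : 0 < N) (z : Fin n → ℝ)
    (v : ℕ → Fin m → ℝ) (k : ℕ) :
    D.prediction N (D.A *ᵥ z + D.B *ᵥ v 0) (D.shifted N z v) k = D.prediction N z v (k + 1) := by
  unfold prediction
  rcases lt_or_ge k N with hk | hk
  · rw [min_eq_left hk.le, min_eq_left (by omega), D.predict_shifted hk,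
      show k - N = 0 by omega, show k + 1 - N = 0 by omega]
  · rw [min_eq_right hk, min_eq_right (by omega), D.predict_shifted_last hN,
      Matrix.mulVec_mulVec, ← pow_succ, show k + 1 - N = k - N + 1 by omega]

theorem Admissible.exists_prediction_le (hD : D.Admissible p) :
    ∃ C ρ, 0 ≤ C ∧ 0 < ρ ∧ ρ < 1 ∧ ∀ z v k, ‖D.prediction p.N z v k‖
      ≤ C * (‖z‖ + ∑ l ∈ Finset.range p.N, ‖v l‖) * ρ ^ k := by
  obtain ⟨C₁, ρ, hC₁, hρ, hρ1, h₁⟩ := hD.schur_K.exists_pow_le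
  obtain ⟨C₂, hC₂, h₂⟩ := exists_norm_predict_le D.A D.B p.N
  refine ⟨C₁ * C₂ / ρ ^ p.N, ρ, by positivity, hρ, hρ1, fun z v k => ?_⟩
  set E := ‖z‖ + ∑ l ∈ Finset.range p.N, ‖v l‖
  have hE : 0 ≤ E := by positivity
  have hpow : ρ ^ (k - p.N) ≤ ρ ^ k / ρ ^ p.N := by
    rw [le_div_iff₀ (by positivity), ← pow_add]
    exact pow_le_pow_of_le_one hρ.le hρ1.le (by omega)
  calc ‖D.prediction p.N z v k‖
      ≤ C₁ * ρ ^ (k - p.N) * ‖predict D.A D.B z v (min k p.N)‖ := h₁ _ _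
    _ ≤ C₁ * (ρ ^ k / ρ ^ p.N) * (C₂ * E) := by
        gcongr
        exact h₂ _ (min_le_right _ _) _ _
    _ = _ := by ring

/-- The weighted supremum `sup_k ρ⁻ᵏ ‖z_k‖` over the infinite prediction. One step along the
prediction contracts it by the factor `ρ`. -/
noncomputable def gauge (D : TubeDesign n m) (N : ℕ) (ρ : ℝ) (z : Fin n → ℝ)
    (v : ℕ → Fin m → ℝ) : ℝ :=
  ⨆ k, ‖D.prediction N z v k‖ / ρ ^ k

/-- A Lyapunov function for the nominal closed loop. The optimal cost alone does not serve: as `Q`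
is only positive semidefinite, it may vanish away from the origin, and its decrease only controls
the deviation of the new optimal sequence from the candidate. It therefore is added, with a large
weight, to the squared gauge of the prediction, which contracts up to that deviation. -/
theorem Admissible.exists_lyapunov (hp : p.Standing) (hD : D.Admissible p)
    {κ : (Fin n → ℝ) → Fin m → ℝ} (hκ : D.IsControlLaw p κ) :
    ∃ (Φ : (Fin n → ℝ) → ℝ) (K θ : ℝ), 1 ≤ K ∧ 0 < θ ∧ θ < 1 ∧ ∀ z ∈ D.feasibleStates p,
      ‖z‖ ^ 2 ≤ Φ z ∧ Φ z ≤ K * ‖z‖ ^ 2 ∧ Φ (D.A *ᵥ z + D.B *ᵥ κ z) ≤ θ * Φ z ∧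
      D.A *ᵥ z + D.B *ᵥ κ z ∈ D.feasibleStates p := by
  obtain ⟨C, ρ, hC, hρ, hρ1, hpred⟩ := hD.exists_prediction_le
  obtain ⟨r, hr, hcost⟩ := hD.exists_le_cost hp
  obtain ⟨M, hM, hopt⟩ := hD.exists_optimal_cost_le hp
  choose! w hw using hκ
  have hρ' : 0 < 1 - ρ := by linarith
  have hbdd : ∀ z v, BddAbove (Set.range fun k => ‖D.prediction p.N z v k‖ / ρ ^ k) := by
    refine fun z v => ⟨C * (‖z‖ + ∑ l ∈ Finset.range p.N, ‖v l‖), ?_⟩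
    rintro _ ⟨k, rfl⟩
    exact (div_le_iff₀ (by positivity)).2 (hpred z v k)
  have hle : ∀ z v k, ‖D.prediction p.N z v k‖ ≤ D.gauge p.N ρ z v * ρ ^ k := fun z v k =>
    (div_le_iff₀ (by positivity)).1 (le_ciSup (hbdd z v) k)
  have hgauge : ∀ z v, D.gauge p.N ρ z v ≤ C * (‖z‖ + ∑ l ∈ Finset.range p.N, ‖v l‖) :=
    fun z v => ciSup_le fun k => (div_le_iff₀ (by positivity)).2 (hpred z v k)
  have hnorm : ∀ z v, ‖z‖ ≤ D.gauge p.N ρ z v := fun z v => by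
    simpa [prediction_zero] using hle z v 0
  have hcost0 : ∀ z v, 0 ≤ D.cost p z v := fun z v => le_trans (by positivity) (hcost z v)
  set μ := 2 * C ^ 2 / ((1 - ρ) * r)
  have hμ : 0 ≤ μ := by positivity
  set K := 2 * C ^ 2 * (1 + M / r) + μ * M + 1
  have hK : 1 ≤ K := le_add_of_nonneg_left (by positivity)
  have hK0 : 0 < K := by linarith
  have hupper : ∀ z ∈ D.feasibleStates p,
      D.gauge p.N ρ z (w z) ^ 2 + μ * D.cost p z (w z) ≤ K * ‖z‖ ^ 2 := by
    intro z hz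
    have h1 := hopt z _ (hw z hz).1
    have h2 : (∑ l ∈ Finset.range p.N, ‖w z l‖) ^ 2 ≤ M / r * ‖z‖ ^ 2 := by
      rw [div_mul_eq_mul_div, le_div_iff₀ hr]
      linarith [hcost z (w z)]
    have h3 := pow_le_pow_left₀ ((norm_nonneg z).trans (hnorm z (w z))) (hgauge z (w z)) 2
    have h4 := mul_le_mul_of_nonneg_left h1 hμ
    have h5 : (‖z‖ + ∑ l ∈ Finset.range p.N, ‖w z l‖) ^ 2 ≤ 2 * (1 + M / r) * ‖z‖ ^ 2 := by
      linarith [sq_nonneg (‖z‖ - ∑ l ∈ Finset.range p.N, ‖w z l‖)]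
    have h6 := mul_le_mul_of_nonneg_left h5 (sq_nonneg C)
    rw [mul_pow] at h3
    simp only [K]
    linarith [sq_nonneg ‖z‖]
  refine ⟨fun z => D.gauge p.N ρ z (w z) ^ 2 + μ * D.cost p z (w z), K, 1 - (1 - ρ) / K, hK,
    ?_, ?_, fun z hz => ?_⟩
  · have : (1 - ρ) / K < 1 := (div_lt_one hK0).2 (by linarith)
    linarith
  · have : 0 < (1 - ρ) / K := by positivity
    linarith
  obtain ⟨ho, hκz⟩ := hw z hz
  have hsh := ho.1.shifted hD hp.N_pos
  rw [hκz]
  set z' := D.A *ᵥ z + D.B *ᵥ w z 0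
  have hz' : z' ∈ D.feasibleStates p := ⟨_, hsh⟩
  set δ := w z' - D.shifted p.N z (w z)
  set σ := ∑ l ∈ Finset.range p.N, ‖δ l‖
  set Ψ := D.gauge p.N ρ z (w z)
  have hΨ : ‖z‖ ≤ Ψ := hnorm _ _
  have hΨ0 : 0 ≤ Ψ := (norm_nonneg z).trans hΨ
  have hlower : ‖z‖ ^ 2 ≤ Ψ ^ 2 := pow_le_pow_left₀ (norm_nonneg z) hΨ 2
  refine ⟨?_, hupper z hz, ?_, hz'⟩
  · have := mul_nonneg hμ (hcost0 z (w z))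
    linarith
  have hdec : D.cost p z' (w z') + r * σ ^ 2 / 2 ≤ D.cost p z (w z) := by
    have h1 := (hw z' hz').1.cost_add_le hp hD hsh
    have h2 := hD.cost_shifted_le hp z (w z)
    have h3 := hcost 0 δ
    linarith
  have hcontr : D.gauge p.N ρ z' (w z') ≤ ρ * Ψ + C * σ := by
    refine ciSup_le fun k => (div_le_iff₀ (by positivity)).2 ?_
    have h1 : D.prediction p.N z' (w z') k
        = D.prediction p.N z (w z) (k + 1) + D.prediction p.N 0 δ k := by
      rw [← D.prediction_shifted hp.N_pos, ← sub_self z', prediction_sub]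
      abel
    rw [h1]
    refine (norm_add_le _ _).trans ((add_le_add (hle z (w z) (k + 1)) (hpred 0 δ k)).trans ?_)
    rw [norm_zero, zero_add, pow_succ]
    exact le_of_eq (by ring)
  have hsq : D.gauge p.N ρ z' (w z') ^ 2 ≤ ρ * Ψ ^ 2 + C ^ 2 * σ ^ 2 / (1 - ρ) := by
    refine (pow_le_pow_left₀ ((norm_nonneg z').trans (hnorm _ _)) hcontr 2).trans ?_
    -- convexity of the square, at `Ψ` and `C σ / (1 - ρ)` with weights `ρ` and `1 - ρ`
    have h1 : ρ * Ψ ^ 2 + C ^ 2 * σ ^ 2 / (1 - ρ) - (ρ * Ψ + C * σ) ^ 2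
        = ρ * (1 - ρ) * (Ψ - C * σ / (1 - ρ)) ^ 2 := by
      field_simp
      ring
    have h2 : 0 ≤ ρ * (1 - ρ) * (Ψ - C * σ / (1 - ρ)) ^ 2 := by positivity
    linarith
  have hμr : μ * (r * σ ^ 2 / 2) = C ^ 2 * σ ^ 2 / (1 - ρ) := by
    simp only [μ]
    field_simp
  have hfin : (1 - ρ) / K * (Ψ ^ 2 + μ * D.cost p z (w z)) ≤ (1 - ρ) * Ψ ^ 2 := by
    rw [div_mul_eq_mul_div, div_le_iff₀ hK0, mul_assoc]
    refine mul_le_mul_of_nonneg_left ((hupper z hz).trans ?_) hρ'.le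
    rw [mul_comm]
    exact mul_le_mul_of_nonneg_right hlower hK0.le
  have := mul_le_mul_of_nonneg_left hdec hμ
  rw [mul_add, hμr] at this
  simp only
  linarith

/-- The nominal closed loop is exponentially stable on the set of feasible states. -/
theorem Admissible.exists_nominal_decay (hp : p.Standing) (hD : D.Admissible p)
    {κ : (Fin n → ℝ) → Fin m → ℝ} (hκ : D.IsControlLaw p κ) :
    ∃ c γ : ℝ, 1 ≤ c ∧ 0 < γ ∧ γ < 1 ∧ ∀ (N : ℕ) (z : ℕ → Fin n → ℝ),
      z 0 ∈ D.feasibleStates p → (∀ i < N, z (i + 1) = D.A *ᵥ z i + D.B *ᵥ κ (z i)) →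
      ∀ i ≤ N, z i ∈ D.feasibleStates p ∧ ‖z i‖ ≤ c * γ ^ i * ‖z 0‖ := by
  obtain ⟨Φ, K, θ, hK, hθ, hθ1, h⟩ := hD.exists_lyapunov hp hκ
  refine ⟨√K, √θ, Real.one_le_sqrt.2 hK, Real.sqrt_pos.2 hθ, ?_, fun N z hz0 hz => ?_⟩
  · rw [Real.sqrt_lt' one_pos]
    linarith
  have key : ∀ i ≤ N, z i ∈ D.feasibleStates p ∧ Φ (z i) ≤ θ ^ i * Φ (z 0) := by
    intro i
    induction i with
    | zero => exact fun _ => ⟨hz0, by simp⟩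
    | succ i ih =>
      intro hi
      obtain ⟨h1, h2⟩ := ih (by omega)
      obtain ⟨-, -, h3, h4⟩ := h _ h1
      rw [hz i (by omega), pow_succ']
      exact ⟨h4, h3.trans (by rw [mul_assoc]; gcongr)⟩
  intro i hi
  obtain ⟨h1, h2⟩ := key i hi
  refine ⟨h1, (pow_le_pow_iff_left₀ (norm_nonneg _) (by positivity) two_ne_zero).1 ?_⟩
  have h3 : (√K * √θ ^ i * ‖z 0‖) ^ 2 = θ ^ i * (K * ‖z 0‖ ^ 2) := by
    rw [mul_pow, mul_pow, ← pow_mul, mul_comm i 2, pow_mul, Real.sq_sqrt (by linarith),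
      Real.sq_sqrt hθ.le]
    ring
  rw [h3]
  refine (h _ h1).1.trans (h2.trans ?_)
  gcongr
  exact (h _ hz0).2.1

end TubeDesign

/-! ### The tube -/

theorem ControlProblem.Standing.exists_ball_subset_What {n m : ℕ} {p : ControlProblem n m}
    (hp : p.Standing) : ∃ ε, 0 < ε ∧ ∀ u : Fin m → ℝ, ‖u‖ ≤ ε → u ∈ p.What := by
  obtain ⟨r, hr, hball⟩ := Metric.mem_nhds_iff.1 (mem_interior_iff_mem_nhds.1 hp.pc_U.2)
  have hα : 0 < 1 - p.α := by linarith [hp.α_lt_one]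
  refine ⟨(1 - p.α) * (r / 2), by positivity, fun u hu => ?_⟩
  rintro _ ⟨y, hy, rfl⟩
  have hu' : (1 - p.α)⁻¹ • u ∈ p.U := by
    refine hball (mem_ball_zero_iff.2 ?_)
    rw [norm_smul, norm_inv, Real.norm_of_nonneg hα.le, inv_mul_lt_iff₀ hα]
    nlinarith
  have := hp.convex_U hu' hy hα.le hp.α_pos.le (by ring)
  rwa [smul_smul, mul_inv_cancel₀ hα.ne', one_smul] at this

namespace TubeDesign

variable {n m : ℕ} {D : TubeDesign n m} {p : ControlProblem n m}

theorem Admissible.What_subset_W (hD : D.Admissible p) {u : Fin m → ℝ} (hu : u ∈ p.What) :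
    D.B *ᵥ u ∈ D.W p :=
  ⟨_, ⟨u, hu, rfl⟩, 0, hD.cset_Wp.2, add_zero _⟩

theorem Admissible.rpi_mem (hD : D.Admissible p) {x w : Fin n → ℝ} (hx : x ∈ D.S)
    (hw : w ∈ D.W p) : (D.A + D.B * D.Kt) *ᵥ x + w ∈ D.S :=
  hD.rpi_S ⟨_, ⟨x, hx, rfl⟩, w, hw, rfl⟩

/-- The tube gain is not assumed to be stabilizing; this follows from the existence of a bounded
robustly invariant set, since the disturbances `B Ŵ` excite all controllable modes. -/
theorem Admissible.isSchur_tube (hp : p.Standing) (hD : D.Admissible p) :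
    IsSchur (D.A + D.B * D.Kt) := by
  obtain ⟨ε, hε, hball⟩ := hp.exists_ball_subset_What
  have hL : IsSchur (D.A + D.B * D.Kt + D.B * (D.K - D.Kt)) := by
    rw [Matrix.mul_sub, add_assoc, add_sub_cancel]
    exact hD.schur_K
  exact hL.of_bounded_robustInvariant (hp.pc_X.1.isBounded.subset hD.S_sub) hD.nonempty_S hε
    fun x hx u hu => hD.rpi_mem hx (hD.What_subset_W (hball u hu))

theorem norm_le_tubeDist (hS : D.S.Nonempty) (x z : Fin n → ℝ) : ‖z‖ ≤ D.tubeDist x z := by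
  refine (Metric.le_infDist (hS.prod (Set.singleton_nonempty 0))).2 ?_
  rintro ⟨y, y'⟩ ⟨-, rfl : y' = 0⟩
  rw [Prod.dist_eq, dist_zero_right]
  exact le_max_right _ _

theorem tubeDist_le {x y z : Fin n → ℝ} (hy : y ∈ D.S) :
    D.tubeDist x z ≤ max ‖x - y‖ ‖z‖ := by
  have hmem : (y, (0 : Fin n → ℝ)) ∈ D.S ×ˢ ({0} : Set (Fin n → ℝ)) :=
    Set.mk_mem_prod hy (Set.mem_singleton 0)
  have h := Metric.infDist_le_dist_of_mem (x := (x, z)) hmem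
  rwa [Prod.dist_eq, dist_zero_right, dist_eq_norm] at h

theorem tubeDist_eq_norm {x z : Fin n → ℝ} (h : x - z ∈ D.S) : D.tubeDist x z = ‖z‖ :=
  le_antisymm (by simpa using tubeDist_le (x := x) (z := z) h) (norm_le_tubeDist ⟨_, h⟩ x z)

theorem tubeDist_nonneg (D : TubeDesign n m) (x z : Fin n → ℝ) : 0 ≤ D.tubeDist x z :=
  Metric.infDist_nonneg

/-- The tube error `x - z` obeys `e⁺ = (A + B K_t) e + w`. -/
theorem error_succ (D : TubeDesign n m) (κ : (Fin n → ℝ) → Fin m → ℝ) (x z w : Fin n → ℝ) :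
    D.A *ᵥ x + D.B *ᵥ tubeInput D κ x z + w - (D.A *ᵥ z + D.B *ᵥ κ z)
      = (D.A + D.B * D.Kt) *ᵥ (x - z) + w := by
  simp only [tubeInput, Matrix.mulVec_add, Matrix.add_mulVec, ← Matrix.mulVec_mulVec,
    Matrix.mulVec_sub]
  abel

/-- Exponential decay of the distance to `S × {0}`, from any initial state of the plant: a solution
of the error system that stays in `S` attracts the error at the rate of `A + B K_t`. -/
theorem Admissible.exists_composite_decay (hp : p.Standing) (hD : D.Admissible p)
    {κ : (Fin n → ℝ) → Fin m → ℝ} (hκ : D.IsControlLaw p κ) :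
    ∃ c γ : ℝ, 1 ≤ c ∧ 0 < γ ∧ γ < 1 ∧ ∀ (N : ℕ) (z : ℕ → Fin n → ℝ),
      z 0 ∈ D.feasibleStates p → (∀ i < N, z (i + 1) = D.A *ᵥ z i + D.B *ᵥ κ (z i)) →
      (∀ i ≤ N, z i ∈ D.feasibleStates p ∧ ‖z i‖ ≤ c * γ ^ i * ‖z 0‖) ∧
      ∀ x : ℕ → Fin n → ℝ, (∀ i < N, ∃ w ∈ D.W p,
          x (i + 1) = D.A *ᵥ x i + D.B *ᵥ tubeInput D κ (x i) (z i) + w) →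
        ∀ i ≤ N, D.tubeDist (x i) (z i) ≤ c * γ ^ i * D.tubeDist (x 0) (z 0) := by
  obtain ⟨c, γ, hc, hγ, hγ1, h⟩ := hD.exists_nominal_decay hp hκ
  obtain ⟨C, ρ, hC, hρ, hρ1, hF⟩ := (hD.isSchur_tube hp).exists_pow_le
  set g := max γ ρ
  have hg : 0 < g := lt_max_of_lt_left hγ
  have hγg : γ ≤ g := le_max_left _ _
  have hρg : ρ ≤ g := le_max_right _ _
  refine ⟨c + 2 * C, g, by linarith, hg, max_lt hγ1 hρ1, fun N z hz0 hz => ?_⟩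
  have hnom := h N z hz0 hz
  refine ⟨fun i hi => ⟨(hnom i hi).1, (hnom i hi).2.trans ?_⟩, fun x hx i hi => ?_⟩
  · gcongr
    linarith
  have hcomp : ∀ y ∈ D.S, ∀ i ≤ N,
      ∃ y' ∈ D.S, x i - z i - y' = (D.A + D.B * D.Kt) ^ i *ᵥ (x 0 - z 0 - y) := by
    intro y hy i
    induction i with
    | zero => exact fun _ => ⟨y, hy, by simp⟩
    | succ i ih =>
      intro hi
      obtain ⟨y', hy', he⟩ := ih (by omega)
      obtain ⟨w, hw, hxi⟩ := hx i (by omega)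
      refine ⟨_, hD.rpi_mem hy' hw, ?_⟩
      rw [hxi, hz i (by omega), error_succ, pow_succ', ← Matrix.mulVec_mulVec, ← he,
        Matrix.mulVec_sub _ (x i - z i)]
      abel
  have hpos : 0 < (c + 2 * C) * g ^ i := mul_pos (by linarith) (by positivity)
  rw [← div_le_iff₀' hpos]
  refine (Metric.le_infDist (hD.nonempty_S.prod (Set.singleton_nonempty 0))).2 ?_
  rintro ⟨y, y'⟩ ⟨hy, rfl : y' = 0⟩
  obtain ⟨y', hy', he⟩ := hcomp y hy i hi
  rw [div_le_iff₀' hpos, Prod.dist_eq, dist_zero_right, dist_eq_norm]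
  set d := max ‖x 0 - y‖ ‖z 0‖
  have hz0d : ‖z 0‖ ≤ d := le_max_right _ _
  have hd : 0 ≤ d := (norm_nonneg _).trans hz0d
  have h1 : ‖z i‖ ≤ c * g ^ i * d :=
    (hnom i hi).2.trans (by gcongr)
  have h2 : ‖x i - z i - y'‖ ≤ C * g ^ i * (2 * d) := by
    rw [he]
    refine (hF i _).trans ?_
    gcongr
    rw [sub_right_comm]
    linarith [norm_sub_le (x 0 - y) (z 0), le_max_left ‖x 0 - y‖ ‖z 0‖]
  have h3 : ‖x i - y'‖ ≤ ‖x i - z i - y'‖ + ‖z i‖ := by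
    rw [← sub_add_cancel (x i - y') (z i), sub_right_comm]
    exact norm_add_le _ _
  refine (tubeDist_le hy').trans (max_le ?_ ?_) <;> linarith [norm_nonneg (x i - z i - y')]

/-- Inside the tube around a feasible nominal state the constraints hold, and the true plant is a
realization of the disturbed prediction model. -/
theorem Admissible.plant_step (hp : p.Standing) (hD : D.Admissible p)
    {κ : (Fin n → ℝ) → Fin m → ℝ} (hκ : D.IsControlLaw p κ) {x z : Fin n → ℝ}
    (hz : z ∈ D.feasibleStates p) (hx : x - z ∈ D.S) :
    x ∈ p.X ∧ tubeInput D κ x z ∈ p.Uhat ∧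
      ∀ (A : Matrix (Fin n) (Fin n) ℝ) (B : Matrix (Fin n) (Fin m) ℝ) (u : Fin m → ℝ),
        (A, B) ∈ p.M → u ∈ p.What → ∃ w ∈ D.W p, A *ᵥ x + B *ᵥ (tubeInput D κ x z + u)
          = D.A *ᵥ x + D.B *ᵥ tubeInput D κ x z + w := by
  obtain ⟨v, ⟨hv, -⟩, hκz⟩ := hκ z hz
  obtain ⟨hzZ, hvV⟩ := hv.1 0 hp.N_pos
  have hxX : x ∈ p.X := by simpa [predict] using hzZ _ hx
  have hu : tubeInput D κ x z ∈ p.Uhat := by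
    rw [tubeInput, hκz]
    exact hvV _ ⟨_, hx, rfl⟩
  refine ⟨hxX, hu, fun A B u hAB hw => ⟨_, ⟨_, ⟨u, hw, rfl⟩, _,
    hD.unc_mem x hxX (tubeInput D κ x z + u) ?_ _ hAB, rfl⟩, ?_⟩⟩
  · rw [add_comm]
    exact hw _ hu
  · simp only [Matrix.sub_mulVec, Matrix.mulVec_add]
    abel

/-- The plant error never leaves the tube. -/
theorem Admissible.plant_invariant (hp : p.Standing) (hD : D.Admissible p)
    {κ : (Fin n → ℝ) → Fin m → ℝ} (hκ : D.IsControlLaw p κ) {N : ℕ} {x z : ℕ → Fin n → ℝ}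
    (hz : ∀ i < N, z i ∈ D.feasibleStates p ∧ z (i + 1) = D.A *ᵥ z i + D.B *ᵥ κ (z i))
    (hx : ∀ i < N, ∃ A B u, (A, B) ∈ p.M ∧ u ∈ p.What ∧
      x (i + 1) = A *ᵥ x i + B *ᵥ (tubeInput D κ (x i) (z i) + u))
    (h0 : x 0 - z 0 ∈ D.S) : ∀ i ≤ N, x i - z i ∈ D.S := by
  intro i
  induction i with
  | zero => exact fun _ => h0
  | succ i ih =>
    intro hi
    obtain ⟨A, B, u, hAB, hu, hxi⟩ := hx i hi
    obtain ⟨w, hw, he⟩ := (hD.plant_step hp hκ (hz i hi).1 (ih (by omega))).2.2 A B u hAB hu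
    rw [hxi, he, (hz i hi).2, error_succ]
    exact hD.rpi_mem (ih (by omega)) hw

end TubeDesign

/-! ### The switched closed loop -/

theorem switchAt_of_lt {β : Type*} {s i : ℕ} (a b : β) (h : i < s) : switchAt s a b i = a :=
  if_pos h

theorem switchAt_add {β : Type*} (s i : ℕ) (a b : β) : switchAt s a b (s + i) = b :=
  if_neg (by omega)

theorem sub_mem_of_mem_singleton_add {n : ℕ} {x z : Fin n → ℝ} {S : Set (Fin n → ℝ)}
    (h : x ∈ {z} + S) : x - z ∈ S := by
  obtain ⟨_, rfl, y, hy, rfl⟩ := h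
  simpa using hy

theorem proposition3 {n m : ℕ} (p : ControlProblem n m) (hp : p.Standing)
    -- the initial design, the redesign, and the two receding-horizon laws
    (D D' : TubeDesign n m) (hD : D.Admissible p) (hD' : D'.Admissible p)
    (κ κ' : (Fin n → ℝ) → Fin m → ℝ)
    (hκ : D.IsControlLaw p κ) (hκ' : D'.IsControlLaw p κ') :
    ∃ c γ : ℝ, 0 < c ∧ 0 < γ ∧ γ < 1 ∧
      -- any switching time and any nominal trajectory for which the switch is permitted
      ∀ (s : ℕ) (z : ℕ → Fin n → ℝ), 1 ≤ s →
        z 0 ∈ D.feasibleStates p →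
        IsNominalLoop (switchAt s D D') (switchAt s κ κ') z →
        z s ∈ D'.feasibleStates p →
        D'.optCost p (z s) - D.optCost p (z (s - 1)) < 0 →
        -- the optimization problems are feasible at all times
        (∀ i, z i ∈ (switchAt s D D' i).feasibleStates p) ∧
        -- the plant, initialized in the tube around the nominal state
        (∀ x : ℕ → Fin n → ℝ,
          IsPlantLoop p (switchAt s D D') (switchAt s κ κ') x z →
          x 0 ∈ {z 0} + D.S →
            (∀ i < s, ConstraintsMet p (switchAt s D D') (switchAt s κ κ') x z i) ∧
            (∀ i ≤ s, D.tubeDist (x i) (z i) ≤ c * γ ^ i * D.tubeDist (x 0) (z 0)) ∧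
            (x s ∈ {z s} + D'.S →
              (∀ i, ConstraintsMet p (switchAt s D D') (switchAt s κ κ') x z i) ∧
              (∀ i, s ≤ i →
                D'.tubeDist (x i) (z i) ≤ c * γ ^ i * D.tubeDist (x 0) (z 0)))) ∧
        -- the composite closed loop with arbitrary disturbances in `W`, then in `W'`
        (∀ x : ℕ → Fin n → ℝ,
          IsDisturbedLoop p (switchAt s D D') (switchAt s κ κ') x z →
          x 0 ∈ D.feasibleStates p + D.S →
            (∀ i ≤ s, D.tubeDist (x i) (z i) ≤ c * γ ^ i * D.tubeDist (x 0) (z 0)) ∧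
            (∀ i, s ≤ i →
              D'.tubeDist (x i) (z i) ≤ c * γ ^ (i - s) * D'.tubeDist (x s) (z s)) ∧
            (x s ∈ {z s} + D'.S → ∀ i, s ≤ i →
              D'.tubeDist (x i) (z i) ≤ c * γ ^ i * D.tubeDist (x 0) (z 0))) := by
  obtain ⟨c₁, γ₁, hc₁, hγ₁, hγ₁1, h₁⟩ := hD.exists_composite_decay hp hκ
  obtain ⟨c₂, γ₂, hc₂, hγ₂, hγ₂1, h₂⟩ := hD'.exists_composite_decay hp hκ'
  set γ := max γ₁ γ₂
  have hγ : 0 < γ := lt_max_of_lt_left hγ₁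
  have hc : 1 ≤ c₁ * c₂ := one_le_mul_of_one_le_of_one_le hc₁ hc₂
  have hle₁ : ∀ i, c₁ * γ₁ ^ i ≤ c₁ * c₂ * γ ^ i := fun i => by
    gcongr
    · exact le_mul_of_one_le_right (by linarith) hc₂
    · exact le_max_left _ _
  have hle₂ : ∀ i, c₂ * γ₂ ^ i ≤ c₁ * c₂ * γ ^ i := fun i => by
    gcongr
    · exact le_mul_of_one_le_left (by linarith) hc₁
    · exact le_max_right _ _
  refine ⟨c₁ * c₂, γ, by linarith, hγ, max_lt hγ₁1 hγ₂1, fun s z _ hz0 hz hzs _ => ?_⟩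
  have hz₁ : ∀ i < s, z (i + 1) = D.A *ᵥ z i + D.B *ᵥ κ (z i) := fun i hi => by
    rw [hz i, switchAt_of_lt _ _ hi, switchAt_of_lt _ _ hi]
  have hz₂ : ∀ i, z (s + (i + 1)) = D'.A *ᵥ z (s + i) + D'.B *ᵥ κ' (z (s + i)) := fun i => by
    rw [← add_assoc, hz (s + i), switchAt_add, switchAt_add]
  obtain ⟨hnom₁, hcomp₁⟩ := h₁ s z hz0 hz₁
  have hnom₂ : ∀ i, z (s + i) ∈ D'.feasibleStates p ∧ ‖z (s + i)‖ ≤ c₂ * γ₂ ^ i * ‖z s‖ :=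
    fun i => (h₂ i (fun j => z (s + j)) hzs fun j _ => hz₂ j).1 i le_rfl
  -- the bounds before and after the switch multiply
  have hnom : ∀ i, s ≤ i → ‖z i‖ ≤ c₁ * c₂ * γ ^ i * ‖z 0‖ := by
    intro i hi
    obtain ⟨j, rfl⟩ := Nat.exists_eq_add_of_le hi
    calc ‖z (s + j)‖ ≤ c₂ * γ₂ ^ j * (c₁ * γ₁ ^ s * ‖z 0‖) :=
          (hnom₂ j).2.trans (by gcongr; exact (hnom₁ s le_rfl).2)
      _ ≤ c₂ * γ ^ j * (c₁ * γ ^ s * ‖z 0‖) := by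
          gcongr
          · exact le_max_right _ _
          · exact le_max_left _ _
      _ = _ := by ring
  have hafter : ∀ (x : ℕ → Fin n → ℝ) (i : ℕ), s ≤ i → x i - z i ∈ D'.S →
      D'.tubeDist (x i) (z i) ≤ c₁ * c₂ * γ ^ i * D.tubeDist (x 0) (z 0) := by
    intro x i hi hxi
    rw [TubeDesign.tubeDist_eq_norm hxi]
    refine (hnom i hi).trans ?_
    gcongr
    exact TubeDesign.norm_le_tubeDist hD.nonempty_S _ _
  refine ⟨fun i => ?_, fun x hx hx0 => ?_, fun x hx _ => ?_⟩
  · rcases lt_or_ge i s with hi | hi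
    · rw [switchAt_of_lt _ _ hi]
      exact (hnom₁ i hi.le).1
    · obtain ⟨j, rfl⟩ := Nat.exists_eq_add_of_le hi
      rw [switchAt_add]
      exact (hnom₂ j).1
  · obtain ⟨A, B, what, hx⟩ := hx
    have hS : ∀ i ≤ s, x i - z i ∈ D.S := by
      refine hD.plant_invariant hp hκ (fun i hi => ⟨(hnom₁ i hi.le).1, hz₁ i hi⟩)
        (fun i hi => ⟨A i, B i, what i, (hx i).1, (hx i).2.1, ?_⟩)
        (sub_mem_of_mem_singleton_add hx0)
      rw [(hx i).2.2, switchAt_of_lt _ _ hi, switchAt_of_lt _ _ hi]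
    have hcon : ∀ i < s, ConstraintsMet p (switchAt s D D') (switchAt s κ κ') x z i := by
      intro i hi
      rw [ConstraintsMet, switchAt_of_lt _ _ hi, switchAt_of_lt _ _ hi]
      have := hD.plant_step hp hκ (hnom₁ i hi.le).1 (hS i hi.le)
      exact ⟨this.1, this.2.1⟩
    refine ⟨hcon, fun i hi => ?_, fun hxs => ?_⟩
    · rw [TubeDesign.tubeDist_eq_norm (hS i hi), TubeDesign.tubeDist_eq_norm (hS 0 s.zero_le)]
      exact (hnom₁ i hi).2.trans (mul_le_mul_of_nonneg_right (hle₁ i) (norm_nonneg _))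
    · have hS' : ∀ i, x (s + i) - z (s + i) ∈ D'.S := by
        intro i
        refine hD'.plant_invariant (N := i) (x := fun j => x (s + j)) (z := fun j => z (s + j))
          hp hκ' (fun j _ => ⟨(hnom₂ j).1, hz₂ j⟩)
          (fun j _ => ⟨A (s + j), B (s + j), what (s + j), (hx _).1, (hx _).2.1, ?_⟩)
          (sub_mem_of_mem_singleton_add hxs) i le_rfl
        rw [← add_assoc, (hx (s + j)).2.2, switchAt_add, switchAt_add]
      refine ⟨fun i => ?_, fun i hi => ?_⟩
      · rcases lt_or_ge i s with hi | hi
        · exact hcon i hi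
        · obtain ⟨j, rfl⟩ := Nat.exists_eq_add_of_le hi
          rw [ConstraintsMet, switchAt_add, switchAt_add]
          have := hD'.plant_step hp hκ' (hnom₂ j).1 (hS' j)
          exact ⟨this.1, this.2.1⟩
      · obtain ⟨j, rfl⟩ := Nat.exists_eq_add_of_le hi
        exact hafter x _ hi (hS' j)
  · have hx₁ : ∀ i < s, ∃ w ∈ D.W p,
        x (i + 1) = D.A *ᵥ x i + D.B *ᵥ tubeInput D κ (x i) (z i) + w := by
      intro i hi
      have := hx i
      rwa [switchAt_of_lt _ _ hi, switchAt_of_lt _ _ hi] at this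
    have hx₂ : ∀ i, ∃ w ∈ D'.W p, x (s + (i + 1))
        = D'.A *ᵥ x (s + i) + D'.B *ᵥ tubeInput D' κ' (x (s + i)) (z (s + i)) + w := by
      intro i
      have := hx (s + i)
      rwa [switchAt_add, switchAt_add] at this
    refine ⟨fun i hi => ?_, fun i hi => ?_, fun hxs i hi => ?_⟩
    · exact (hcomp₁ x hx₁ i hi).trans
        (mul_le_mul_of_nonneg_right (hle₁ i) (D.tubeDist_nonneg _ _))
    · obtain ⟨j, rfl⟩ := Nat.exists_eq_add_of_le hi
      rw [Nat.add_sub_cancel_left]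
      exact ((h₂ j (fun j => z (s + j)) hzs fun j _ => hz₂ j).2 (fun j => x (s + j))
        (fun j _ => hx₂ j) j le_rfl).trans
        (mul_le_mul_of_nonneg_right (hle₂ j) (D'.tubeDist_nonneg _ _))
    · have hS' : ∀ j, x (s + j) - z (s + j) ∈ D'.S := by
        intro j
        induction j with
        | zero => exact sub_mem_of_mem_singleton_add hxs
        | succ j ih =>
          obtain ⟨w, hw, hxj⟩ := hx₂ j
          rw [hxj, hz₂ j, TubeDesign.error_succ]
          exact hD'.rpi_mem ih hw
      obtain ⟨j, rfl⟩ := Nat.exists_eq_add_of_le hi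
      exact hafter x _ hi (hS' j)
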